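/- Let $n\ge 2$. An $n$-Lie algebra is a vector space $\mathfrak g$ with a skew-symmetric $n$-linear bracket $[\cdot,\dots,\cdot]$ satisfying $$[[x_1,\dots,x_n],y_2,\dots,y_n]=\sum_{i=1}^n[x_1,\dots,[x_i,y_2,\dots,y_n],\dots,x_n];$$ all $n$-Lie algebras here are finite-dimensional over $\mathbb C$. For subspaces $W_1,\dots,W_n$ write $[W_1,\dots,W_n]$ for the span of all $[w_1,\dots,w_n]$ with $w_i\in W_i$. An ideal is a subspace $I$ with $[I,\mathfrak g,\dots,\mathfrak g]\subseteq I$; it is solvable if $I^{(s)}=0$ for some $s\ge 0$, where $I^{(0)}=I$ and $I^{(s+1)}=[I^{(s)},\dots,I^{(s)}]$. The solvable radical $\mathfrak r$ is the largest solvable ideal. A subalgebra $A$ is abelian if $[A,\dots,A]=0$. The centralizer of a subspace $W$ is $C_{\mathfrak g}(W)=\{x\in\mathfrak g : [x,W,\mathfrak g,\dots,\mathfrak g]=0\}$. A metric $n$-Lie algebra $(\mathfrak g,B)$ is an $n$-Lie algebra with a non-degenerate symmetric bilinear form $B$ such that $B([x_1,\dots,x_{n-1},y_1],y_2)=-B([x_1,\dots,x_{n-1},y_2],y_1)$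 for all $x_i,y_1,y_2\in\mathfrak g$. Write $W^\perp=\{x\in\mathfrak g : B(w,x)=0 \text{ for all } w\in W\}$; $W$ is isotropic if $W\subseteq W^\perp$ and non-degenerate if $W\cap W^\perp=0$. An isomaximal ideal is an isotropic ideal not properly contained in any other isotropic ideal. $(\mathfrak g,B)$ is decomposable if $\mathfrak g=I\oplus J$ for nonzero non-degenerate ideals $I,J$, and indecomposable otherwise. **Theorem 3.4.** Let $(\mathfrak g,B)$ be a metric $n$-Lie algebra with solvable radical $\mathfrak r\neq 0$, and let $I$ be an isomaximal ideal. Then $$\mathfrak r\cap\mathfrak r^\perp\subseteq I\subseteq\mathfrak r.$$ If moreover $(\mathfrak g,B)$ is indecomposable, then: 1. $I^\perp\subseteq\mathfrak r$. 2. $I^\perp/I$ is an abelian subalgebra of $\mathfrak g/I$. 3. $I^\perp/I=[I^\perp/I,\,I^\perp/I,\,\mathfrak g/I,\dots,\mathfrak g/I]\oplus\bigl(C_{\mathfrak g/I}(I^\perp/I)\cap(I^\perp/I)\bigr)$. -/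

import Mathlib

/-- An `n`-Lie algebra structure on a complex vector space `g`: a skew-symmetric `n`-linear bracket
(over `ℂ`, skew-symmetric and alternating are the same) such that
`[[x₁, …, xₙ], y₂, …, yₙ] = ∑ᵢ [x₁, …, [xᵢ, y₂, …, yₙ], …, xₙ]`.
The identity is written with the slot of the inner bracket among the `y`'s being an arbitrary
position `j`; by skew-symmetry each position gives the same condition as the first one. -/
structure NLieAlgebra (n : ℕ) (g : Type*) [AddCommGroup g] [Module ℂ g] where
  /-- The bracket `[x₁, …, xₙ]`. -/
  bracket : g [⋀^Fin n]→ₗ[ℂ] g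
  /-- The generalized Jacobi (Filippov) identity. -/
  jacobi : ∀ (x y : Fin n → g) (j : Fin n),
    bracket (Function.update y j (bracket x)) =
      ∑ i, bracket (Function.update x i (bracket (Function.update y j (x i))))

namespace NLieAlgebra

variable {n : ℕ} {g : Type*} [AddCommGroup g] [Module ℂ g]

/-- `[W₁, …, Wₙ]`: the subspace spanned by all brackets `[x₁, …, xₙ]` with `xᵢ ∈ Wᵢ`. -/
def bracketSpan (L : NLieAlgebra n g) (W : Fin n → Submodule ℂ g) : Submodule ℂ g :=
  Submodule.span ℂ {z | ∃ x : Fin n → g, (∀ i, x i ∈ W i) ∧ L.bracket x = z}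

/-- `A` is a subalgebra: `[A, …, A] ⊆ A`. -/
def IsSubalgebra (L : NLieAlgebra n g) (A : Submodule ℂ g) : Prop :=
  ∀ x : Fin n → g, (∀ i, x i ∈ A) → L.bracket x ∈ A

/-- `I` is an ideal: a bracket with at least one entry in `I` lies in `I`. -/
def IsIdeal (L : NLieAlgebra n g) (I : Submodule ℂ g) : Prop :=
  ∀ x : Fin n → g, (∃ i, x i ∈ I) → L.bracket x ∈ I

/-- `A` is an abelian subalgebra: a subalgebra with `[A, …, A] = 0`. -/
def IsAbelianSubalgebra (L : NLieAlgebra n g) (A : Submodule ℂ g) : Prop :=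
  L.IsSubalgebra A ∧ L.bracketSpan (fun _ => A) = ⊥

/-- The derived series `I⁽⁰⁾ = I`, `I⁽ˢ⁺¹⁾ = [I⁽ˢ⁾, …, I⁽ˢ⁾]`. -/
def derivedSeries (L : NLieAlgebra n g) (I : Submodule ℂ g) : ℕ → Submodule ℂ g
  | 0 => I
  | s + 1 => L.bracketSpan (fun _ => derivedSeries L I s)

/-- `I` is a solvable ideal: an ideal with `I⁽ˢ⁾ = 0` for some `s`. -/
def IsSolvableIdeal (L : NLieAlgebra n g) (I : Submodule ℂ g) : Prop :=
  L.IsIdeal I ∧ ∃ s, L.derivedSeries I s = ⊥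

/-- The solvable radical: the sum of all solvable ideals. In finite dimension this is the largest
solvable ideal, since a sum of two solvable ideals is a solvable ideal. -/
def radical (L : NLieAlgebra n g) : Submodule ℂ g :=
  sSup {I | L.IsSolvableIdeal I}

/-- The centralizer `{x | [x, W, g, …, g] = 0}`: all brackets having `x` in one slot and an element
of `W` in another slot vanish. -/
def centralizer (L : NLieAlgebra n g) (W : Submodule ℂ g) : Submodule ℂ g where
  carrier := {x | ∀ (v : Fin n → g) (i j : Fin n), i ≠ j → v j ∈ W →
    L.bracket (Function.update v i x) = 0}
  zero_mem' := fun v i _ _ _ => L.bracket.map_update_zero v i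
  add_mem' := fun {x y} hx hy v i j hij hv => by
    rw [L.bracket.map_update_add, hx v i j hij hv, hy v i j hij hv, add_zero]
  smul_mem' := fun c x hx v i j hij hv => by
    rw [L.bracket.map_update_smul, hx v i j hij hv, smul_zero]

/-- Modulo an ideal `I`, the bracket depends only on the classes of its entries. -/
theorem bracket_sub_mem (L : NLieAlgebra n g) {I : Submodule ℂ g} (hI : L.IsIdeal I)
    (x y : Fin n → g) (h : ∀ i, x i - y i ∈ I) : L.bracket x - L.bracket y ∈ I := by
  classical
  have key : ∀ s : Finset (Fin n), L.bracket (s.piecewise x y) - L.bracket y ∈ I := by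
    intro s
    induction s using Finset.induction_on with
    | empty => simp
    | insert a s ha ih =>
      rw [Finset.piecewise_insert]
      have h1 : L.bracket (Function.update (s.piecewise x y) a (x a)) -
          L.bracket (s.piecewise x y) ∈ I := by
        have h2 : L.bracket (s.piecewise x y) =
            L.bracket (Function.update (s.piecewise x y) a (y a)) := by
          congr 1
          rw [eq_comm, Function.update_eq_self_iff]
          simp [ha]
        rw [h2, ← L.bracket.map_update_sub]
        exact hI _ ⟨a, by simpa using h a⟩
      simpa using I.add_mem h1 ih
  simpa using key Finset.univ

/-- The bracket of representatives represents the bracket in `g ⧸ I`. -/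
theorem mkQ_bracket_out (L : NLieAlgebra n g) {I : Submodule ℂ g} (hI : L.IsIdeal I)
    (v : Fin n → g ⧸ I) (x : Fin n → g) (h : ∀ i, I.mkQ (x i) = v i) :
    I.mkQ (L.bracket fun i => (v i).out) = I.mkQ (L.bracket x) := by
  rw [Submodule.mkQ_apply, Submodule.mkQ_apply, Submodule.Quotient.eq]
  refine L.bracket_sub_mem hI _ _ fun i => ?_
  rw [← Submodule.Quotient.eq, ← Submodule.mkQ_apply, ← Submodule.mkQ_apply, h i]
  exact Submodule.Quotient.mk_out (v i)

/-- The bracket on `g ⧸ I`, computed on representatives. -/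
noncomputable def quotientBracket (L : NLieAlgebra n g) (I : Submodule ℂ g) (hI : L.IsIdeal I) :
    (g ⧸ I) [⋀^Fin n]→ₗ[ℂ] (g ⧸ I) where
  toFun v := I.mkQ (L.bracket fun i => (v i).out)
  map_update_add' := by
    intro _ v i a b
    have hu : ∀ (w : g ⧸ I) (k : Fin n), I.mkQ
        (Function.update (fun i => (v i).out) i w.out k) = Function.update v i w k := by
      intro w k
      by_cases hk : k = i
      · subst hk; simp
      · simp [hk]
    rw [L.mkQ_bracket_out hI _ (Function.update (fun i => (v i).out) i (a.out + b.out)),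
      L.mkQ_bracket_out hI _ _ (hu a), L.mkQ_bracket_out hI _ _ (hu b),
      L.bracket.map_update_add, map_add]
    intro k
    by_cases hk : k = i
    · subst hk; simp
    · simp [hk]
  map_update_smul' := by
    intro _ v i c a
    have hu : ∀ (w : g ⧸ I) (k : Fin n), I.mkQ
        (Function.update (fun i => (v i).out) i w.out k) = Function.update v i w k := by
      intro w k
      by_cases hk : k = i
      · subst hk; simp
      · simp [hk]
    rw [L.mkQ_bracket_out hI _ (Function.update (fun i => (v i).out) i (c • a.out)),
      L.mkQ_bracket_out hI _ _ (hu a), L.bracket.map_update_smul, map_smul]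
    intro k
    by_cases hk : k = i
    · subst hk; simp
    · simp [hk]
  map_eq_zero_of_eq' := by
    intro v i j h hij
    rw [L.bracket.map_eq_zero_of_eq _ (by simp [h]) hij, map_zero]

theorem quotientBracket_mkQ (L : NLieAlgebra n g) (I : Submodule ℂ g) (hI : L.IsIdeal I)
    (x : Fin n → g) : L.quotientBracket I hI (fun i => I.mkQ (x i)) = I.mkQ (L.bracket x) :=
  L.mkQ_bracket_out hI _ x fun _ => rfl

/-- The quotient `n`-Lie algebra `g ⧸ I` of `g` by an ideal `I`, with
`[x₁ + I, …, xₙ + I] = [x₁, …, xₙ] + I`. -/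
noncomputable def quotient (L : NLieAlgebra n g) (I : Submodule ℂ g) (hI : L.IsIdeal I) :
    NLieAlgebra n (g ⧸ I) where
  bracket := L.quotientBracket I hI
  jacobi := by
    intro v w j
    obtain ⟨x, rfl⟩ : ∃ x : Fin n → g, (fun i => I.mkQ (x i)) = v :=
      ⟨fun i => (v i).out, by ext i; simp⟩
    obtain ⟨y, rfl⟩ : ∃ y : Fin n → g, (fun i => I.mkQ (y i)) = w :=
      ⟨fun i => (w i).out, by ext i; simp⟩
    have hu : ∀ (z : Fin n → g) (k : Fin n) (a : g),
        Function.update (fun i => I.mkQ (z i)) k (I.mkQ a) =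
          fun i => I.mkQ (Function.update z k a i) := by
      intro z k a
      ext i
      by_cases hk : i = k
      · subst hk; simp
      · simp [hk]
    simp only [quotientBracket_mkQ, hu, L.jacobi x y j, map_sum]

/-- `B` is a metric on the `n`-Lie algebra: a non-degenerate symmetric bilinear form with
`B([x₁, …, xₙ₋₁, y₁], y₂) = -B([x₁, …, xₙ₋₁, y₂], y₁)`. The invariance is written for `y₁`, `y₂` in
an arbitrary slot `i`; by skew-symmetry each slot gives the same condition as the last one. -/
structure IsMetric (L : NLieAlgebra n g) (B : LinearMap.BilinForm ℂ g) : Prop where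
  symm : B.IsSymm
  nondegenerate : B.Nondegenerate
  invariant : ∀ (x : Fin n → g) (i : Fin n) (y₁ y₂ : g),
    B (L.bracket (Function.update x i y₁)) y₂ = -B (L.bracket (Function.update x i y₂)) y₁

/-- `I` is an isotropic ideal: an ideal with `I ⊆ I^⊥`. -/
def IsIsotropicIdeal (L : NLieAlgebra n g) (B : LinearMap.BilinForm ℂ g) (I : Submodule ℂ g) :
    Prop :=
  L.IsIdeal I ∧ I ≤ B.orthogonal I

/-- `I` is an isomaximal ideal: it is maximal, for inclusion, among the isotropic ideals. -/
def IsIsomaximal (L : NLieAlgebra n g) (B : LinearMap.BilinForm ℂ g) (I : Submodule ℂ g) : Prop :=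
  Maximal (L.IsIsotropicIdeal B) I

/-- `(g, B)` is decomposable: `g = I ⊕ J` for nonzero ideals `I`, `J` that are non-degenerate, that
is `I ∩ I^⊥ = 0` and `J ∩ J^⊥ = 0`. -/
def IsDecomposable (L : NLieAlgebra n g) (B : LinearMap.BilinForm ℂ g) : Prop :=
  ∃ I J : Submodule ℂ g, L.IsIdeal I ∧ L.IsIdeal J ∧ I ≠ ⊥ ∧ J ≠ ⊥ ∧
    I ⊓ B.orthogonal I = ⊥ ∧ J ⊓ B.orthogonal J = ⊥ ∧ IsCompl I J

end NLieAlgebra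

-- Write `r` for the radical. Invariance of `B` gives `[K, K^⊥, g, …, g] = 0` for every ideal `K`,
-- so isotropic ideals are abelian and lie in `r`. In particular `I ⊆ r`, whence `r^⊥ ⊆ I^⊥`; then
-- `I + (r ∩ r^⊥)` is isotropic and maximality gives `r ∩ r^⊥ ⊆ I`.
--
-- Indecomposability enters only through `r^⊥ ⊆ r` (`orthogonal_radical_le_radical`). Otherwise the
-- image of `r^⊥` in `g/r` contains a minimal ideal `J`. It has a complementary ideal
-- (`exists_isCompl_isIdeal`), with preimage `T` in `g`, and `T + r^⊥ = g`. Hence `T^⊥ ∩ r = 0`;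
-- since `T ∩ T^⊥` is isotropic, it lies in `r` and vanishes, and `g = T ⊕ T^⊥` is a decomposition.
-- The complement of `J` comes from a Casimir operator, whose existence rests on a Cartan-type
-- criterion (`eq_zero_of_trace_adSpan_eq_zero`). Now `r^⊥ ⊆ I`, so `I^⊥ ⊆ r`.
--
-- The last two claims use one duality: an ideal `W` with `I ⊆ W ⊆ I^⊥` satisfies `W ∩ W^⊥ = I` and
-- `W + W^⊥ = I^⊥`. Applied to terms of the derived series of `I^⊥`, it gives abelianness; applied
-- to `W = I + [I^⊥, I^⊥, g, …, g]`, whose orthogonal is the centralizer part modulo `I`, it gives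
-- the direct sum.

attribute [local instance 100] LieRing.ofAssociativeRing

/-! ### Trace forms, Engel's theorem and Casimir elements for spaces of endomorphisms -/

open Module in
/-- In an internal direct sum, there is an endomorphism acting on each summand by a prescribed
scalar. -/
theorem DirectSum.IsInternal.exists_end_smul {ι K V : Type*} [DecidableEq ι] [Field K]
    [AddCommGroup V] [Module K V] {N : ι → Submodule K V} (h : DirectSum.IsInternal N)
    (c : ι → K) : ∃ y : Module.End K V, ∀ i, ∀ v ∈ N i, y v = c i • v := by
  let e := LinearEquiv.ofBijective (DirectSum.coeLinearMap N) h
  refine ⟨(DirectSum.toModule K ι V fun i => c i • (N i).subtype) ∘ₗ e.symm.toLinearMap,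
    fun i v hv => ?_⟩
  have : e.symm v = DirectSum.lof K ι (fun i => N i) i ⟨v, hv⟩ := by
    rw [LinearEquiv.symm_apply_eq]
    exact (DirectSum.coeLinearMap_lof N i ⟨v, hv⟩).symm
  simp [this]

open Module in
/-- An endomorphism `y` acting by `conj μ` on each generalized eigenspace of `a` detects
nilpotency of `a` through `trace (a * y)`. -/
theorem Module.End.isNilpotent_of_trace_mul_conj {V : Type*} [AddCommGroup V] [Module ℂ V]
    [FiniteDimensional ℂ V] (a y : Module.End ℂ V)
    (hy : ∀ μ, ∀ v ∈ a.maxGenEigenspace μ, y v = (starRingEnd ℂ μ) • v)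
    (htr : LinearMap.trace ℂ V (a * y) = 0) : IsNilpotent a := by
  classical
  have hds := DirectSum.isInternal_submodule_of_iSupIndep_of_iSup_eq_top
    a.independent_maxGenEigenspace a.iSup_maxGenEigenspace_eq_top
  have hfin : {μ | a.maxGenEigenspace μ ≠ ⊥}.Finite :=
    WellFoundedGT.finite_ne_bot_of_iSupIndep a.independent_maxGenEigenspace
  have ha : ∀ μ, Set.MapsTo a (a.maxGenEigenspace μ) (a.maxGenEigenspace μ) := fun μ =>
    a.mapsTo_maxGenEigenspace_of_comm (Commute.refl a) μ
  have hay : ∀ μ, Set.MapsTo (a * y) (a.maxGenEigenspace μ) (a.maxGenEigenspace μ) := by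
    intro μ v hv
    rw [Module.End.mul_apply, hy μ v hv]
    exact ha μ ((a.maxGenEigenspace μ).smul_mem _ hv)
  -- Here `a * y = conj μ • (a - μ) + |μ|²` with `a - μ` nilpotent. The traces are therefore
  -- nonnegative reals, and a zero sum forces each to vanish.
  have key : ∀ μ, LinearMap.trace ℂ _ ((a * y).restrict (hay μ)) =
      ((Complex.normSq μ * finrank ℂ (a.maxGenEigenspace μ) : ℝ) : ℂ) := by
    intro μ
    have hnil := a.isNilpotent_restrict_maxGenEigenspace_sub_algebraMap μ
    have h0 := (LinearMap.isNilpotent_trace_of_isNilpotent hnil).eq_zero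
    have h1 : (a * y).restrict (hay μ) =
        (starRingEnd ℂ μ) • (a - algebraMap ℂ (Module.End ℂ V) μ).restrict
          (a.mapsTo_maxGenEigenspace_of_comm (Algebra.mul_sub_algebraMap_commutes a μ) μ) +
        ((starRingEnd ℂ μ) * μ) • LinearMap.id := by
      ext v
      change a (y v) = starRingEnd ℂ μ • (a v - μ • (v : V)) + (starRingEnd ℂ μ * μ) • (v : V)
      rw [hy μ v v.2, map_smul, smul_sub, mul_smul, sub_add_cancel]
    rw [h1, map_add, map_smul, map_smul, h0, LinearMap.trace_id]
    simp [Complex.normSq_eq_conj_mul_self]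
  rw [LinearMap.trace_eq_sum_trace_restrict' hds hfin hay, Finset.sum_congr rfl fun μ _ => key μ,
    ← Complex.ofReal_sum, Complex.ofReal_eq_zero,
    Finset.sum_eq_zero_iff_of_nonneg (fun μ _ => mul_nonneg (Complex.normSq_nonneg μ) (Nat.cast_nonneg _))] at htr
  have hbot : ∀ μ, μ ≠ 0 → a.maxGenEigenspace μ = ⊥ := by
    intro μ hμ
    by_contra hne
    have := htr μ (by simpa using hne)
    rcases mul_eq_zero.mp this with h | h
    · exact hμ (Complex.normSq_eq_zero.mp h)
    · exact hne (Submodule.finrank_eq_zero.mp (by exact_mod_cast h))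
  have htop : a.maxGenEigenspace 0 = ⊤ := by
    rw [eq_top_iff, ← a.iSup_maxGenEigenspace_eq_top]
    refine iSup_le fun μ => ?_
    by_cases hμ : μ = 0
    · rw [hμ]
    · rw [hbot μ hμ]; exact bot_le
  rw [Module.End.maxGenEigenspace_eq_genEigenspace_finrank, Module.End.genEigenspace_nat] at htop
  refine ⟨finrank ℂ V, LinearMap.ker_eq_top.mp ?_⟩
  simpa using htop

/-- If `m₀ ≤ m` are spaces of endomorphisms with `[m₀, m] ⊆ m₀` that are orthogonal for the trace
form, then every element of `m₀ ∩ [m, m]` is nilpotent. -/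
theorem Module.End.isNilpotent_of_trace_orthogonal {V : Type*} [AddCommGroup V] [Module ℂ V]
    [FiniteDimensional ℂ V] {m₀ m : Submodule ℂ (Module.End ℂ V)} (hle : m₀ ≤ m)
    (hlie : ∀ a ∈ m₀, ∀ b ∈ m, ⁅a, b⁆ ∈ m₀)
    (htr : ∀ a ∈ m₀, ∀ b ∈ m, LinearMap.trace ℂ V (a * b) = 0)
    {a : Module.End ℂ V} (ha₀ : a ∈ m₀)
    (ha : a ∈ Submodule.span ℂ {z | ∃ b ∈ m, ∃ c ∈ m, ⁅b, c⁆ = z}) : IsNilpotent a := by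
  classical
  have hds := DirectSum.isInternal_submodule_of_iSupIndep_of_iSup_eq_top
    a.independent_maxGenEigenspace a.iSup_maxGenEigenspace_eq_top
  obtain ⟨y, hy⟩ := hds.exists_end_smul (fun μ => starRingEnd ℂ μ)
  let A : Module.End ℂ (Module.End ℂ V) := LieAlgebra.ad ℂ (Module.End ℂ V) a
  have hAa : ∀ b, A b = ⁅a, b⁆ := fun b => rfl
  -- `y` acts on the generalized eigenspaces of `ad a` by conjugate eigenvalues
  have hyb : ∀ μ, ∀ b ∈ A.maxGenEigenspace μ, ⁅y, b⁆ = (starRingEnd ℂ μ) • b := by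
    intro μ b hb
    have : LinearMap.eqLocus ⁅y, b⁆ ((starRingEnd ℂ μ) • b) = ⊤ := by
      rw [eq_top_iff, ← a.iSup_maxGenEigenspace_eq_top]
      refine iSup_le fun ν v hv => ?_
      -- Since `b` shifts eigenvalues by `μ`, the commutator acts by `conj (μ + ν) - conj ν = conj
      -- μ`.
      have hbv : b v ∈ a.maxGenEigenspace (μ + ν) := by
        have := LieModule.lie_mem_maxGenEigenspace_toEnd (R := ℂ) (L := Module.End ℂ V) (M := V)
          (x := a) (y := b) (m := v) (χ₁ := μ) (χ₂ := ν) hb hv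
        exact this
      rw [LinearMap.mem_eqLocus, Ring.lie_def]
      simp [hy _ _ hbv, hy _ _ hv, add_smul]
    exact LinearMap.eqLocus_eq_top.mp this
  -- `ad a` maps `m` into `m₀`, so modulo `m₀` the operator `A - μ` is the invertible scalar `-μ`.
  have hmem : ∀ μ : ℂ, μ ≠ 0 → ∀ k : ℕ, ∀ b ∈ m,
      ((A - μ • (1 : Module.End ℂ (Module.End ℂ V))) ^ k) b ∈ m₀ → b ∈ m₀ := by
    intro μ hμ k
    induction k with
    | zero => intro b _ h; simpa using h
    | succ k ih =>
      intro b hb h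
      rw [pow_succ, Module.End.mul_apply] at h
      have h1 : A b ∈ m₀ := hlie a ha₀ b hb
      have h2 := ih _ (by
        simpa using m.sub_mem (hle h1) (m.smul_mem μ hb)) h
      have h3 : μ • b ∈ m₀ := by
        have := m₀.sub_mem h1 h2
        simpa using this
      exact (m₀.smul_mem_iff hμ).mp h3
  -- Split `m` into generalized eigenspaces of `ad a`: `ad y` kills the one for `0` and scales the
  -- others, which lie in `m₀`.
  have hym : ∀ b ∈ m, ⁅y, b⁆ ∈ m₀ := by
    intro b hb
    have hinv : ∀ x ∈ m, A x ∈ m := fun x hx => hle (hlie a ha₀ x hx)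
    have hdec : m ≤ ⨆ μ, m ⊓ A.maxGenEigenspace μ := by
      have h1 := Submodule.inf_iSup_genEigenspace (p := m) (f := A) hinv ⊤
      have h2 : ⨆ μ, A.genEigenspace μ ⊤ = ⊤ := A.iSup_maxGenEigenspace_eq_top
      rw [h2, inf_top_eq] at h1
      exact h1.le
    let F : Module.End ℂ V →ₗ[ℂ] Module.End ℂ V := LieAlgebra.ad ℂ (Module.End ℂ V) y
    suffices m ≤ m₀.comap F from this hb
    refine hdec.trans (iSup_le fun μ b hb => ?_)
    change ⁅y, b⁆ ∈ m₀
    rw [hyb μ b hb.2]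
    by_cases hμ : μ = 0
    · simp [hμ]
    · refine m₀.smul_mem _ ?_
      obtain ⟨k, hk⟩ := Module.End.mem_maxGenEigenspace _ _ _ |>.mp hb.2
      exact hmem μ hμ k b hb.1 (by rw [hk]; exact m₀.zero_mem)
  refine Module.End.isNilpotent_of_trace_mul_conj a y hy ?_
  -- With `y` fixed, the trace is linear in `a`, so commutators suffice: `tr([b, c] y) = tr([y, b]
  -- c) = 0`, as `[y, b] ∈ m₀`.
  clear hy hyb hmem A hAa hds ha₀
  induction ha using Submodule.span_induction with
  | mem z hz =>
    obtain ⟨b, hb, c, hc, rfl⟩ := hz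
    have h1 := htr _ (hym b hb) c hc
    have h2 : LinearMap.trace ℂ V (⁅b, c⁆ * y) = LinearMap.trace ℂ V (⁅y, b⁆ * c) := by
      rw [Ring.lie_def, Ring.lie_def, sub_mul, sub_mul, map_sub, map_sub,
        LinearMap.trace_mul_comm ℂ (b * c) y, mul_assoc c b y, LinearMap.trace_mul_comm ℂ c (b * y),
        ← mul_assoc]
    rw [h2, h1]
  | zero => simp
  | add x z _ _ hx hz => rw [add_mul, map_add, hx, hz, add_zero]
  | smul c x _ hx => rw [smul_mul_assoc, map_smul, hx, smul_zero]

/-- **Engel's theorem** for spaces of nilpotent endomorphisms: they have a common kernel vector in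
each nonzero invariant subspace. -/
theorem Module.End.exists_ne_zero_forall_eq_zero {K V : Type*} [Field K] [AddCommGroup V]
    [Module K V] [FiniteDimensional K V] (N : Submodule K (Module.End K V))
    (hN : ∀ a ∈ N, ∀ b ∈ N, ⁅a, b⁆ ∈ N) (hnil : ∀ a ∈ N, IsNilpotent a)
    {J : Submodule K V} (hJ : J ≠ ⊥) (hNJ : ∀ a ∈ N, ∀ v ∈ J, a v ∈ J) :
    ∃ v ∈ J, v ≠ 0 ∧ ∀ a ∈ N, a v = 0 := by
  let N' : LieSubalgebra K (Module.End K V) := { N with lie_mem' := fun {a b} ha hb => hN a ha b hb }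
  let J' : LieSubmodule K N' V := { J with lie_mem := fun {a v} hv => hNJ a.1 a.2 v hv }
  have hnilp : LieModule.IsNilpotent N' J' := by
    rw [LieModule.isNilpotent_iff_forall' (R := K)]
    intro a
    obtain ⟨k, hk⟩ := hnil a.1 a.2
    refine ⟨k, LinearMap.ext fun v => Subtype.ext ?_⟩
    have : ∀ (j : ℕ) (v : J'), (((LieModule.toEnd K N' J' a) ^ j) v : V) = (a.1 ^ j) v := by
      intro j
      induction j with
      | zero => intro v; rfl
      | succ j ih => intro v; rw [pow_succ, pow_succ, Module.End.mul_apply, ih]; rfl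
    rw [this, hk]; rfl
  have : Nontrivial J' := (Submodule.nontrivial_iff_ne_bot (p := J)).mpr hJ
  have hnt := LieModule.nontrivial_max_triv_of_isNilpotent K N' J'
  obtain ⟨⟨v, hv⟩, hv0⟩ := exists_ne (0 : LieModule.maxTrivSubmodule K N' J')
  refine ⟨v, v.2, fun h => hv0 (Subtype.ext (Subtype.ext h)), fun a ha => ?_⟩
  have := (LieModule.mem_maxTrivSubmodule K N' J' v).mp hv ⟨a, ha⟩
  exact congrArg Subtype.val this

open Module in
/-- The Casimir element of a space `m` of endomorphisms with non-degenerate trace form. -/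
theorem Module.End.exists_casimir {K V : Type*} [Field K] [AddCommGroup V]
    [Module K V] [FiniteDimensional K V] (m : Submodule K (Module.End K V))
    (hm : ∀ a ∈ m, (∀ b ∈ m, LinearMap.trace K V (a * b) = 0) → a = 0)
    {J : Submodule K V} (hJ : ∀ a ∈ m, ∀ v, a v ∈ J) :
    ∃ Ω : Module.End K V, (∀ v, Ω v ∈ J) ∧ LinearMap.trace K V Ω = finrank K m ∧
      ∀ D : Module.End K V, (∀ a ∈ m, ⁅D, a⁆ ∈ m) → Commute D Ω := by
  classical
  let τ : LinearMap.BilinForm K m :=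
    ((LinearMap.mul K (Module.End K V)).compr₂ (LinearMap.trace K V)).compl₁₂ m.subtype m.subtype
  have hτ : ∀ a b : m, τ a b = LinearMap.trace K V (a.1 * b.1) := fun a b => rfl
  have hsymm : τ.IsSymm := ⟨fun a b => by simp [hτ, LinearMap.trace_mul_comm K a.1 b.1]⟩
  have hnd : τ.Nondegenerate := by
    refine (LinearMap.IsRefl.nondegenerate_iff_separatingLeft hsymm.isRefl).mpr ?_
    exact fun a ha => Subtype.ext (hm a.1 a.2 fun b hb => ha ⟨b, hb⟩)
  let b := finBasis K m
  let b' := τ.dualBasis hnd b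
  have hb' : ∀ (x : m), x = ∑ j, τ x (b j) • b' j := by
    intro x
    conv_lhs => rw [← b'.sum_repr x]
    simp [b', LinearMap.BilinForm.dualBasis_repr_apply]
  have hb : ∀ (x : m), x = ∑ j, τ x (b' j) • b j := by
    intro x
    have h := LinearMap.BilinForm.dualBasis_dualBasis hnd hsymm b
    conv_lhs => rw [← b.sum_repr x]
    refine Finset.sum_congr rfl fun j _ => ?_
    conv_lhs => rw [← h]
    rw [LinearMap.BilinForm.dualBasis_repr_apply, h]
  refine ⟨∑ i, (b i).1 * (b' i).1, fun v => ?_, ?_, fun D hD => ?_⟩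
  · rw [LinearMap.sum_apply]
    exact J.sum_mem fun i _ => hJ _ (b i).2 _
  · rw [map_sum]
    have : ∀ i, LinearMap.trace K V ((b i).1 * (b' i).1) = 1 := fun i => by
      rw [← hτ, LinearMap.BilinForm.apply_dualBasis_right hnd hsymm]; simp
    simp [this]
  -- `ad D` is skew for the trace form, so its matrices in the dual bases are negative transposes
  -- and the two halves of `[D, Ω]` cancel.
  · let d : m → m := fun a => ⟨⁅D, a.1⁆, hD a.1 a.2⟩
    have hskew : ∀ x z : m, τ (d x) z = - τ x (d z) := by
      intro x z
      rw [hτ, hτ]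
      simp only [d, Ring.lie_def, sub_mul, mul_sub, map_sub]
      rw [mul_assoc D, LinearMap.trace_mul_comm K D, mul_assoc x.1 D, mul_assoc x.1 z.1]
      ring
    have h1 : ∀ i, ⁅D, (b i).1⁆ = ∑ j, τ (d (b i)) (b' j) • (b j).1 := fun i => by
      have := congrArg Subtype.val (hb (d (b i)))
      simpa [d] using this
    have h2 : ∀ i, ⁅D, (b' i).1⁆ = ∑ j, - τ (d (b j)) (b' i) • (b' j).1 := fun i => by
      have := congrArg Subtype.val (hb' (d (b' i)))
      have h3 : ∀ j, τ (d (b' i)) (b j) = - τ (d (b j)) (b' i) := fun j => by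
        rw [hskew, hsymm.eq]
      simpa [d, h3] using this
    have h4 : ⁅D, ∑ i, (b i).1 * (b' i).1⁆ = 0 := by
      rw [lie_sum]
      have : ∀ i, ⁅D, (b i).1 * (b' i).1⁆ = ⁅D, (b i).1⁆ * (b' i).1 + (b i).1 * ⁅D, (b' i).1⁆ := by
        intro i; simp only [Ring.lie_def]; noncomm_ring
      simp only [this, h1, h2, Finset.sum_add_distrib, Finset.sum_mul, Finset.mul_sum]
      rw [Finset.sum_comm, ← Finset.sum_add_distrib]
      refine Finset.sum_eq_zero fun i _ => ?_
      rw [← Finset.sum_add_distrib]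
      refine Finset.sum_eq_zero fun j _ => ?_
      simp
    rw [Ring.lie_def, sub_eq_zero] at h4
    exact h4

/-! ### Inner derivations and ideals -/

namespace NLieAlgebra

variable {n : ℕ} {g : Type*} [AddCommGroup g] [Module ℂ g]

/-- The endomorphism `v ↦ [x₁, …, v, …, xₙ]`, with `v` in slot `i`. -/
noncomputable def ad (L : NLieAlgebra n g) (x : Fin n → g) (i : Fin n) : Module.End ℂ g :=
  L.bracket.toMultilinearMap.toLinearMap x i

theorem ad_apply (L : NLieAlgebra n g) (x : Fin n → g) (i : Fin n) (v : g) :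
    L.ad x i v = L.bracket (Function.update x i v) := rfl

theorem ad_apply_self (L : NLieAlgebra n g) (x : Fin n → g) (i : Fin n) :
    L.ad x i (x i) = L.bracket x := by
  rw [ad_apply, Function.update_eq_self]

theorem ad_update_zero (L : NLieAlgebra n g) (x : Fin n → g) {i k : Fin n} (h : k ≠ i) :
    L.ad (Function.update x k 0) i = 0 := by
  ext v
  rw [ad_apply]
  exact L.bracket.map_coord_zero k (by simp [h])

theorem isIdeal_iff_ad (L : NLieAlgebra n g) {I : Submodule ℂ g} :
    L.IsIdeal I ↔ ∀ x i, ∀ v ∈ I, L.ad x i v ∈ I := by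
  refine ⟨fun h x i v hv => h _ ⟨i, by simpa using hv⟩, fun h x ⟨i, hi⟩ => ?_⟩
  rw [← L.ad_apply_self x i]
  exact h x i _ hi

theorem isIdeal_top (L : NLieAlgebra n g) : L.IsIdeal ⊤ := fun _ _ => trivial

theorem IsIdeal.inf {L : NLieAlgebra n g} {I J : Submodule ℂ g} (hI : L.IsIdeal I)
    (hJ : L.IsIdeal J) : L.IsIdeal (I ⊓ J) :=
  fun x ⟨i, hi⟩ => ⟨hI x ⟨i, hi.1⟩, hJ x ⟨i, hi.2⟩⟩

theorem IsIdeal.sup {L : NLieAlgebra n g} {I J : Submodule ℂ g} (hI : L.IsIdeal I)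
    (hJ : L.IsIdeal J) : L.IsIdeal (I ⊔ J) := by
  rw [isIdeal_iff_ad] at *
  intro x i v hv
  obtain ⟨a, ha, b, hb, rfl⟩ := Submodule.mem_sup.mp hv
  rw [map_add]
  exact add_mem (Submodule.mem_sup_left (hI x i a ha)) (Submodule.mem_sup_right (hJ x i b hb))

/-- `D` is a derivation of the `n`-Lie algebra. -/
def IsDerivation (L : NLieAlgebra n g) (D : Module.End ℂ g) : Prop :=
  ∀ x : Fin n → g, D (L.bracket x) = ∑ i, L.bracket (Function.update x i (D (x i)))

theorem isDerivation_ad (L : NLieAlgebra n g) (y : Fin n → g) (j : Fin n) :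
    L.IsDerivation (L.ad y j) := fun x => L.jacobi x y j

/-- The commutator removes exactly the term of the Leibniz rule in which `D` hits the free slot. -/
theorem IsDerivation.lie_ad {L : NLieAlgebra n g} {D : Module.End ℂ g} (hD : L.IsDerivation D)
    (x : Fin n → g) (i : Fin n) :
    ⁅D, L.ad x i⁆ = ∑ k ∈ Finset.univ.erase i, L.ad (Function.update x k (D (x k))) i := by
  ext v
  rw [Ring.lie_def, LinearMap.sub_apply, Module.End.mul_apply, Module.End.mul_apply, ad_apply,
    hD, ← Finset.add_sum_erase _ _ (Finset.mem_univ i), LinearMap.sum_apply, ad_apply]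
  simp only [Function.update_self, Function.update_idem, add_sub_cancel_left]
  refine Finset.sum_congr rfl fun k hk => ?_
  have hki : k ≠ i := Finset.ne_of_mem_erase hk
  rw [ad_apply, Function.update_of_ne hki, Function.update_comm hki]

theorem IsDerivation.bracketSpan_mem {L : NLieAlgebra n g} {D : Module.End ℂ g}
    (hD : L.IsDerivation D) {W : Fin n → Submodule ℂ g} (hW : ∀ i, ∀ v ∈ W i, D v ∈ W i) {z : g}
    (hz : z ∈ L.bracketSpan W) : D z ∈ L.bracketSpan W := by
  suffices L.bracketSpan W ≤ (L.bracketSpan W).comap D from this hz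
  refine Submodule.span_le.mpr ?_
  rintro _ ⟨x, hx, rfl⟩
  change D (L.bracket x) ∈ L.bracketSpan W
  rw [hD]
  refine Submodule.sum_mem _ fun i _ => Submodule.subset_span ⟨_, fun k => ?_, rfl⟩
  by_cases hk : k = i
  · subst hk; simpa using hW k _ (hx k)
  · simpa [hk] using hx k

theorem isIdeal_bracketSpan {L : NLieAlgebra n g} {W : Fin n → Submodule ℂ g}
    (hW : ∀ i, L.IsIdeal (W i)) : L.IsIdeal (L.bracketSpan W) :=
  L.isIdeal_iff_ad.mpr fun y j _ hz =>
    (L.isDerivation_ad y j).bracketSpan_mem (fun i => L.isIdeal_iff_ad.mp (hW i) y j) hz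

theorem bracketSpan_le_of_isIdeal {L : NLieAlgebra n g} {W : Fin n → Submodule ℂ g}
    {I : Submodule ℂ g} (hI : L.IsIdeal I) (i : Fin n) (hi : W i ≤ I) : L.bracketSpan W ≤ I := by
  refine Submodule.span_le.mpr ?_
  rintro _ ⟨x, hx, rfl⟩
  exact hI x ⟨i, hi (hx i)⟩

theorem bracket_mem_bracketSpan (L : NLieAlgebra n g) {W : Fin n → Submodule ℂ g} {x : Fin n → g}
    (hx : ∀ i, x i ∈ W i) : L.bracket x ∈ L.bracketSpan W :=
  Submodule.subset_span ⟨x, hx, rfl⟩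

theorem bracketSpan_mono (L : NLieAlgebra n g) {W W' : Fin n → Submodule ℂ g}
    (h : ∀ i, W i ≤ W' i) : L.bracketSpan W ≤ L.bracketSpan W' :=
  Submodule.span_mono fun _ ⟨x, hx, hz⟩ => ⟨x, fun i => h i (hx i), hz⟩

theorem bracketSpan_le (L : NLieAlgebra n g) {W : Fin n → Submodule ℂ g} {A : Submodule ℂ g} :
    L.bracketSpan W ≤ A ↔ ∀ x : Fin n → g, (∀ i, x i ∈ W i) → L.bracket x ∈ A := by
  refine ⟨fun h x hx => h (L.bracket_mem_bracketSpan hx), fun h => Submodule.span_le.mpr ?_⟩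
  rintro _ ⟨x, hx, rfl⟩
  exact h x hx

/-- The space spanned by the endomorphisms `v ↦ [x₁, …, v, …, xₙ]` with all `xₖ ∈ J`. -/
def adSpan (L : NLieAlgebra n g) (J : Submodule ℂ g) : Submodule ℂ (Module.End ℂ g) :=
  Submodule.span ℂ {a | ∃ x i, (∀ k, x k ∈ J) ∧ L.ad x i = a}

theorem ad_mem_adSpan (L : NLieAlgebra n g) {J : Submodule ℂ g} {x : Fin n → g}
    (hx : ∀ k, x k ∈ J) (i : Fin n) : L.ad x i ∈ L.adSpan J :=
  Submodule.subset_span ⟨x, i, hx, rfl⟩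

theorem isDerivation_of_mem_adSpan {L : NLieAlgebra n g} {J : Submodule ℂ g}
    {a : Module.End ℂ g} (ha : a ∈ L.adSpan J) : L.IsDerivation a := by
  induction ha using Submodule.span_induction with
  | mem a h => obtain ⟨x, i, -, rfl⟩ := h; exact L.isDerivation_ad x i
  | zero => intro x; simp
  | add a b _ _ ha hb => intro x; simp [ha x, hb x, Finset.sum_add_distrib]
  | smul c a _ ha => intro x; simp [ha x, Finset.smul_sum]

theorem IsDerivation.lie_mem_adSpan {L : NLieAlgebra n g} {J : Submodule ℂ g}
    {D a : Module.End ℂ g} (hD : L.IsDerivation D) (hDJ : ∀ v ∈ J, D v ∈ J)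
    (ha : a ∈ L.adSpan J) : ⁅D, a⁆ ∈ L.adSpan J := by
  induction ha using Submodule.span_induction with
  | mem a h =>
    obtain ⟨x, i, hx, rfl⟩ := h
    rw [hD.lie_ad]
    refine Submodule.sum_mem _ fun k _ => L.ad_mem_adSpan (fun l => ?_) i
    by_cases hl : l = k
    · subst hl; simpa using hDJ _ (hx l)
    · simpa [hl] using hx l
  | zero => rw [Ring.lie_def]; simp
  | add a b _ _ ha hb =>
    rw [Ring.lie_def] at *
    rw [mul_add, add_mul, add_sub_add_comm]
    exact add_mem ha hb
  | smul c a _ ha =>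
    rw [Ring.lie_def] at *
    rw [mul_smul_comm, smul_mul_assoc, ← smul_sub]
    exact Submodule.smul_mem _ _ ha

/-- As `n ≥ 2`, some slot other than the free one is filled from `J`. -/
theorem IsIdeal.adSpan_apply_mem (hn : 2 ≤ n) {L : NLieAlgebra n g} {J : Submodule ℂ g}
    (hJ : L.IsIdeal J) {a : Module.End ℂ g} (ha : a ∈ L.adSpan J) (v : g) : a v ∈ J := by
  induction ha using Submodule.span_induction with
  | mem a h =>
    obtain ⟨x, i, hx, rfl⟩ := h
    have : Nontrivial (Fin n) := Fin.nontrivial_iff_two_le.mpr hn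
    obtain ⟨k, hk⟩ := exists_ne i
    exact hJ _ ⟨k, by simpa [hk] using hx k⟩
  | zero => simp
  | add a b _ _ ha hb => exact add_mem ha hb
  | smul c a _ ha => exact Submodule.smul_mem _ _ ha

/-- The common kernel in an ideal of a space of endomorphisms normalized by all inner derivations
is an ideal. -/
theorem IsIdeal.exists_isIdeal_annihilated {L : NLieAlgebra n g} {J : Submodule ℂ g}
    (hJ : L.IsIdeal J) (N : Submodule ℂ (Module.End ℂ g))
    (hN : ∀ x i, ∀ a ∈ N, ⁅L.ad x i, a⁆ ∈ N) :
    ∃ K, L.IsIdeal K ∧ ∀ v, v ∈ K ↔ v ∈ J ∧ ∀ a ∈ N, a v = 0 := by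
  refine ⟨{ carrier := {v | v ∈ J ∧ ∀ a ∈ N, a v = 0}
            zero_mem' := ⟨J.zero_mem, fun a _ => map_zero a⟩
            add_mem' := fun h h' => ⟨J.add_mem h.1 h'.1, fun a ha => by
              rw [map_add, h.2 a ha, h'.2 a ha, add_zero]⟩
            smul_mem' := fun c v h => ⟨J.smul_mem c h.1, fun a ha => by
              rw [map_smul, h.2 a ha, smul_zero]⟩ }, ?_, fun v => Iff.rfl⟩
  refine L.isIdeal_iff_ad.mpr fun x i v hv => ⟨L.isIdeal_iff_ad.mp hJ x i v hv.1, fun a ha => ?_⟩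
  have h := hv.2 _ (hN x i a ha)
  rw [Ring.lie_def, LinearMap.sub_apply, Module.End.mul_apply, Module.End.mul_apply, hv.2 a ha,
    map_zero, zero_sub, neg_eq_zero] at h
  exact h

/-! ### Complements of minimal ideals -/

/-- In an `n`-Lie algebra without nonzero abelian ideals, the inner derivations by elements of a
minimal ideal have a non-degenerate trace form. -/
theorem eq_zero_of_trace_adSpan_eq_zero [FiniteDimensional ℂ g] (hn : 2 ≤ n)
    {L : NLieAlgebra n g}
    (hss : ∀ A, L.IsIdeal A → (∀ x : Fin n → g, (∀ i, x i ∈ A) → L.bracket x = 0) → A = ⊥)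
    {J : Submodule ℂ g} (hJ : L.IsIdeal J) (hJ0 : J ≠ ⊥)
    (hmin : ∀ K, L.IsIdeal K → K ≤ J → K ≠ ⊥ → K = J) (a : Module.End ℂ g) (ha : a ∈ L.adSpan J)
    (htr : ∀ b ∈ L.adSpan J, LinearMap.trace ℂ g (a * b) = 0) : a = 0 := by
  set m := L.adSpan J with hm
  have hadm : ∀ x i, ∀ b ∈ m, ⁅L.ad x i, b⁆ ∈ m := fun x i b hb =>
    (L.isDerivation_ad x i).lie_mem_adSpan (fun v hv => L.isIdeal_iff_ad.mp hJ x i v hv) hb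
  have hmm : ∀ b ∈ m, ∀ c ∈ m, ⁅b, c⁆ ∈ m := fun b hb c hc =>
    (isDerivation_of_mem_adSpan hb).lie_mem_adSpan (fun v _ => hJ.adSpan_apply_mem hn hb v) hc
  let m₀ : Submodule ℂ (Module.End ℂ g) :=
    { carrier := {a | a ∈ m ∧ ∀ b ∈ m, LinearMap.trace ℂ g (a * b) = 0}
      zero_mem' := ⟨m.zero_mem, fun b _ => by simp⟩
      add_mem' := fun h h' => ⟨m.add_mem h.1 h'.1, fun b hb => by
        rw [add_mul, map_add, h.2 b hb, h'.2 b hb, add_zero]⟩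
      smul_mem' := fun c v h => ⟨m.smul_mem c h.1, fun b hb => by
        rw [smul_mul_assoc, map_smul, h.2 b hb, smul_zero]⟩ }
  have hnorm : ∀ D : Module.End ℂ g, (∀ b ∈ m, ⁅D, b⁆ ∈ m) → ∀ a ∈ m₀, ⁅D, a⁆ ∈ m₀ := by
    intro D hD a ha
    refine ⟨hD a ha.1, fun b hb => ?_⟩
    have h := ha.2 _ (hD b hb)
    rw [Ring.lie_def, mul_sub, map_sub, sub_eq_zero] at h
    rw [Ring.lie_def, sub_mul, map_sub, sub_eq_zero, mul_assoc, LinearMap.trace_mul_comm,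
      mul_assoc, ← h, mul_assoc]
  have hm₀m : ∀ a ∈ m₀, ∀ b ∈ m, ⁅a, b⁆ ∈ m₀ := fun a ha b hb => by
    rw [← lie_skew]
    exact m₀.neg_mem (hnorm b (fun c hc => hmm b hb c hc) a ha)
  let S : Submodule ℂ (Module.End ℂ g) := Submodule.span ℂ {z | ∃ b ∈ m, ∃ c ∈ m, ⁅b, c⁆ = z}
  have hS : ∀ D : Module.End ℂ g, (∀ b ∈ m, ⁅D, b⁆ ∈ m) → ∀ a ∈ S, ⁅D, a⁆ ∈ S := by
    intro D hD a ha
    suffices S ≤ S.comap (LieAlgebra.ad ℂ (Module.End ℂ g) D : _ →ₗ[ℂ] _) from this ha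
    refine Submodule.span_le.mpr ?_
    rintro _ ⟨b, hb, c, hc, rfl⟩
    change ⁅D, ⁅b, c⁆⁆ ∈ S
    rw [leibniz_lie]
    exact S.add_mem (Submodule.subset_span ⟨_, hD b hb, c, hc, rfl⟩)
      (Submodule.subset_span ⟨b, hb, _, hD c hc, rfl⟩)
  -- `m₀ ∩ [m, m]` consists of nilpotent endomorphisms and acts trivially on `J`
  have hann : ∀ a ∈ m₀ ⊓ S, ∀ v ∈ J, a v = 0 := by
    obtain ⟨K, hK, hKmem⟩ := hJ.exists_isIdeal_annihilated (m₀ ⊓ S) fun x i a ha =>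
      ⟨hnorm _ (hadm x i) a ha.1, hS _ (hadm x i) a ha.2⟩
    obtain ⟨v, hvJ, hv0, hv⟩ := Module.End.exists_ne_zero_forall_eq_zero (m₀ ⊓ S)
      (fun a ha b hb => ⟨hm₀m a ha.1 b hb.1.1, hS a (hmm a ha.1.1) b hb.2⟩)
      (fun a ha => Module.End.isNilpotent_of_trace_orthogonal (m₀ := m₀)
        (fun _ ha => ha.1) hm₀m
        (fun a ha => ha.2) ha.1 ha.2) hJ0
      (fun a ha v _ => hJ.adSpan_apply_mem hn ha.1.1 v)
    -- Engel's vector makes the annihilated ideal nonzero, so minimality makes it all of `J`.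
    have hKJ : K = J := hmin K hK (fun w hw => ((hKmem w).mp hw).1)
      fun h => hv0 ((Submodule.mem_bot ℂ).mp (h ▸ (hKmem v).mpr ⟨hvJ, hv⟩))
    intro a ha w hw
    exact ((hKmem w).mp (hKJ ▸ hw)).2 a ha
  have ha₀ : a ∈ m₀ := ⟨ha, htr⟩
  have hcomm : ∀ b ∈ m, ∀ v ∈ J, a (b v) = b (a v) := by
    intro b hb v hv
    have := hann ⁅a, b⁆ ⟨hm₀m a ha₀ b hb, Submodule.subset_span ⟨a, ha, b, hb, rfl⟩⟩ v hv
    rwa [Ring.lie_def, LinearMap.sub_apply, sub_eq_zero] at this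
  have hJJ : L.bracketSpan (fun _ => J) = J := by
    refine hmin _ (isIdeal_bracketSpan fun _ => hJ)
      (bracketSpan_le_of_isIdeal hJ ⟨0, by omega⟩ le_rfl) fun h => hJ0 (hss J hJ fun x hx => ?_)
    exact (Submodule.mem_bot ℂ).mp (h ▸ L.bracket_mem_bracketSpan hx)
  have haJ : ∀ v ∈ J, a v = 0 := by
    -- On `J = [J, …, J]`, `a` is a derivation commuting with every `ad x`, so each Leibniz term
    -- equals `a [x]`. Thus `a [x] = n • a [x]`, which forces `a [x] = 0` because `n ≠ 1`.
    suffices L.bracketSpan (fun _ => J) ≤ LinearMap.ker a from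
      fun v hv => this (hJJ.symm ▸ hv)
    rw [bracketSpan_le]
    intro x hx
    have h1 : ∀ i, L.bracket (Function.update x i (a (x i))) = a (L.bracket x) := fun i => by
      rw [← ad_apply, ← hcomm _ (L.ad_mem_adSpan hx i) _ (hx i), ad_apply_self]
    have h2 := isDerivation_of_mem_adSpan ha x
    simp only [h1, Finset.sum_const, Finset.card_univ, Fintype.card_fin] at h2
    have h3 : ((n : ℂ) - 1) • a (L.bracket x) = 0 := by
      rw [sub_smul, one_smul, Nat.cast_smul_eq_nsmul, ← h2, sub_self]
    rcases smul_eq_zero.mp h3 with h | h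
    · have : (n : ℂ) = (1 : ℕ) := by rw [Nat.cast_one]; exact sub_eq_zero.mp h
      have := Nat.cast_injective this
      omega
    · exact h
  obtain ⟨Z, hZ, hZmem⟩ := hJ.exists_isIdeal_annihilated m hadm
  have hZ0 : Z = ⊥ := by
    by_contra hne
    have hZJ := hmin Z hZ (fun w hw => ((hZmem w).mp hw).1) hne
    refine hJ0 (hss J hJ fun x hx => ?_)
    rw [← L.ad_apply_self x ⟨0, by omega⟩]
    exact ((hZmem _).mp (hZJ.symm ▸ hx ⟨0, by omega⟩)).2 _ (L.ad_mem_adSpan hx _)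
  ext v
  -- Since `a` kills `J`, it commutes with each generator `ad x` of `m`, so `ad x (a v) = a (ad x v)
  -- = 0`.
  suffices a v ∈ Z by rw [hZ0] at this; exact this
  refine (hZmem _).mpr ⟨hJ.adSpan_apply_mem hn ha v, fun b hb => ?_⟩
  induction hb using Submodule.span_induction with
  | mem b h =>
    obtain ⟨x, i, hx, rfl⟩ := h
    have h1 := (isDerivation_of_mem_adSpan ha).lie_ad x i
    rw [Finset.sum_eq_zero fun k hk => by
      rw [haJ _ (hx k), L.ad_update_zero x (Finset.ne_of_mem_erase hk)]] at h1
    have h2 := LinearMap.congr_fun h1 v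
    rw [Ring.lie_def, LinearMap.sub_apply, Module.End.mul_apply, Module.End.mul_apply,
      haJ _ (hJ.adSpan_apply_mem hn (L.ad_mem_adSpan hx i) v), zero_sub, LinearMap.zero_apply,
      neg_eq_zero] at h2
    exact h2
  | zero => simp
  | add b c _ _ hb hc => rw [LinearMap.add_apply, hb, hc, add_zero]
  | smul c b _ hb => rw [LinearMap.smul_apply, hb, smul_zero]

/-- In an `n`-Lie algebra without nonzero abelian ideals, every minimal ideal has a complementary
ideal. -/
theorem exists_isCompl_isIdeal [FiniteDimensional ℂ g] (hn : 2 ≤ n) {L : NLieAlgebra n g}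
    (hss : ∀ A, L.IsIdeal A → (∀ x : Fin n → g, (∀ i, x i ∈ A) → L.bracket x = 0) → A = ⊥)
    {J : Submodule ℂ g} (hJ : L.IsIdeal J) (hJ0 : J ≠ ⊥)
    (hmin : ∀ K, L.IsIdeal K → K ≤ J → K ≠ ⊥ → K = J) :
    ∃ K, L.IsIdeal K ∧ IsCompl J K := by
  obtain ⟨Ω, hΩJ, hΩtr, hΩ⟩ := Module.End.exists_casimir (L.adSpan J)
    (eq_zero_of_trace_adSpan_eq_zero hn hss hJ hJ0 hmin)
    (fun a ha v => hJ.adSpan_apply_mem hn ha v)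
  have hcomm : ∀ x i, Commute (L.ad x i) Ω := fun x i => hΩ _ fun a ha =>
    (L.isDerivation_ad x i).lie_mem_adSpan (fun v hv => L.isIdeal_iff_ad.mp hJ x i v hv) ha
  obtain ⟨k, hk⟩ := Filter.eventually_atTop.mp Ω.eventually_isCompl_ker_pow_range_pow
  -- Fitting decomposition of `Ω`. The exponent is kept positive so that the range lies in `J`.
  have hcompl := hk (k + 1) (Nat.le_succ k)
  have hcomm' : ∀ x i v, L.ad x i ((Ω ^ (k + 1)) v) = (Ω ^ (k + 1)) (L.ad x i v) := fun x i v =>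
    LinearMap.congr_fun ((hcomm x i).pow_right (k + 1)).eq v
  have hker : L.IsIdeal (LinearMap.ker (Ω ^ (k + 1))) := L.isIdeal_iff_ad.mpr fun x i v hv => by
    rw [LinearMap.mem_ker] at *
    rw [← hcomm', hv, map_zero]
  have hrange : L.IsIdeal (LinearMap.range (Ω ^ (k + 1))) := by
    refine L.isIdeal_iff_ad.mpr ?_
    rintro x i _ ⟨v, rfl⟩
    exact ⟨L.ad x i v, (hcomm' x i v).symm⟩
  have hrJ : LinearMap.range (Ω ^ (k + 1)) ≤ J := by
    rintro _ ⟨v, rfl⟩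
    rw [pow_succ', Module.End.mul_apply]
    exact hΩJ _
  have hr0 : LinearMap.range (Ω ^ (k + 1)) ≠ ⊥ := by
    intro h
    -- Nilpotency would give `dim (adSpan J) = tr Ω = 0`, making `J` abelian.
    have hnil : IsNilpotent Ω := ⟨k + 1, LinearMap.range_eq_bot.mp h⟩
    have h0 := (LinearMap.isNilpotent_trace_of_isNilpotent hnil).eq_zero
    rw [hΩtr, Nat.cast_eq_zero, Submodule.finrank_eq_zero] at h0
    refine hJ0 (hss J hJ fun x hx => ?_)
    have h1 := L.ad_mem_adSpan hx ⟨0, by omega⟩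
    rw [h0, Submodule.mem_bot] at h1
    rw [← L.ad_apply_self x ⟨0, by omega⟩, h1, LinearMap.zero_apply]
  rw [hmin _ hrange hrJ hr0] at hcompl
  exact ⟨_, hker, hcompl.symm⟩

end NLieAlgebra

namespace NLieAlgebra

variable {n : ℕ} {g : Type*} [AddCommGroup g] [Module ℂ g]

/-! ### The solvable radical -/

theorem isIdeal_sSup {L : NLieAlgebra n g} {S : Set (Submodule ℂ g)}
    (hS : ∀ I ∈ S, L.IsIdeal I) : L.IsIdeal (sSup S) := by
  rw [isIdeal_iff_ad]
  intro x i v hv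
  suffices sSup S ≤ (sSup S).comap (L.ad x i) from this hv
  exact sSup_le fun I hI w hw => le_sSup hI (L.isIdeal_iff_ad.mp (hS I hI) x i w hw)

theorem isIdeal_radical (L : NLieAlgebra n g) : L.IsIdeal L.radical :=
  isIdeal_sSup fun _ h => h.1

theorem isIdeal_derivedSeries {L : NLieAlgebra n g} {I : Submodule ℂ g} (hI : L.IsIdeal I)
    (s : ℕ) : L.IsIdeal (L.derivedSeries I s) := by
  induction s with
  | zero => exact hI
  | succ s ih => exact isIdeal_bracketSpan fun _ => ih

theorem derivedSeries_mono (L : NLieAlgebra n g) {I J : Submodule ℂ g} (h : I ≤ J) (s : ℕ) :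
    L.derivedSeries I s ≤ L.derivedSeries J s := by
  induction s with
  | zero => exact h
  | succ s ih => exact L.bracketSpan_mono fun _ => ih

theorem derivedSeries_add (L : NLieAlgebra n g) (I : Submodule ℂ g) (s t : ℕ) :
    L.derivedSeries I (s + t) = L.derivedSeries (L.derivedSeries I s) t := by
  induction t with
  | zero => rfl
  | succ t ih =>
    rw [← Nat.add_assoc, derivedSeries, derivedSeries, ih]

/-- Dropping the `J`-components of the entries changes a bracket only by an element of `J`. -/
theorem derivedSeries_sup_le {L : NLieAlgebra n g} (I : Submodule ℂ g) {J : Submodule ℂ g}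
    (hJ : L.IsIdeal J) (s : ℕ) : L.derivedSeries (I ⊔ J) s ≤ L.derivedSeries I s ⊔ J := by
  induction s with
  | zero => exact le_rfl
  | succ s ih =>
    refine L.bracketSpan_le.mpr fun x hx => ?_
    choose y hy z hz hyz using fun i => Submodule.mem_sup.mp (ih (hx i))
    rw [← add_sub_cancel (L.bracket y) (L.bracket x)]
    refine add_mem (Submodule.mem_sup_left (L.bracket_mem_bracketSpan hy))
      (Submodule.mem_sup_right (L.bracket_sub_mem hJ x y fun i => ?_))
    rw [← hyz i, add_sub_cancel_left]
    exact hz i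

theorem IsSolvableIdeal.sup {L : NLieAlgebra n g} {I J : Submodule ℂ g}
    (hI : L.IsSolvableIdeal I) (hJ : L.IsSolvableIdeal J) : L.IsSolvableIdeal (I ⊔ J) := by
  obtain ⟨hI, s, hs⟩ := hI
  obtain ⟨hJ, t, ht⟩ := hJ
  refine ⟨hI.sup hJ, s + t, ?_⟩
  rw [eq_bot_iff, ← ht, derivedSeries_add]
  refine L.derivedSeries_mono ((derivedSeries_sup_le I hJ s).trans ?_) t
  rw [hs, bot_sup_eq]

theorem derivedSeries_bot (hn : 0 < n) (L : NLieAlgebra n g) (s : ℕ) :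
    L.derivedSeries ⊥ s = ⊥ := by
  induction s with
  | zero => rfl
  | succ s ih =>
    rw [derivedSeries, ih, eq_bot_iff, bracketSpan_le]
    exact fun x hx => L.bracket.map_coord_zero ⟨0, hn⟩ (hx _)

theorem isSolvableIdeal_of_bracket_eq_zero {L : NLieAlgebra n g} {I : Submodule ℂ g}
    (hI : L.IsIdeal I) (h : ∀ x : Fin n → g, (∀ i, x i ∈ I) → L.bracket x = 0) :
    L.IsSolvableIdeal I :=
  ⟨hI, 1, eq_bot_iff.mpr (L.bracketSpan_le.mpr fun x hx => h x hx)⟩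

/-- In finite dimension the radical is a solvable ideal. -/
theorem isSolvableIdeal_radical [FiniteDimensional ℂ g] (L : NLieAlgebra n g) :
    L.IsSolvableIdeal L.radical := by
  have hbot : L.IsSolvableIdeal ⊥ :=
    ⟨fun x ⟨i, hi⟩ => L.bracket.map_coord_zero i hi, 0, rfl⟩
  obtain ⟨M, hM⟩ := exists_maximal_of_wellFoundedGT L.IsSolvableIdeal ⟨⊥, hbot⟩
  have : L.radical = M := le_antisymm
    (sSup_le fun K hK => le_sup_left.trans (hM.le_of_ge (IsSolvableIdeal.sup hK hM.prop)
      le_sup_right)) (le_sSup hM.prop)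
  exact this ▸ hM.prop

/-! ### Quotients -/

theorem quotient_bracket_mkQ (L : NLieAlgebra n g) {I : Submodule ℂ g} (hI : L.IsIdeal I)
    (x : Fin n → g) : (L.quotient I hI).bracket (fun i => I.mkQ (x i)) = I.mkQ (L.bracket x) :=
  L.quotientBracket_mkQ I hI x

/-- Representatives are taken in `A` slot by slot whenever possible, so hypotheses on single slots
survive lifting. -/
theorem exists_lift_mkQ (I A : Submodule ℂ g) (v : Fin n → g ⧸ I) :
    ∃ x : Fin n → g, (fun i => I.mkQ (x i)) = v ∧ ∀ i, v i ∈ A.map I.mkQ → x i ∈ A := by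
  have : ∀ i, ∃ a, I.mkQ a = v i ∧ (v i ∈ A.map I.mkQ → a ∈ A) := fun i => by
    by_cases h : v i ∈ A.map I.mkQ
    · obtain ⟨a, ha, hav⟩ := h
      exact ⟨a, hav, fun _ => ha⟩
    · obtain ⟨a, ha⟩ := I.mkQ_surjective (v i)
      exact ⟨a, ha, fun h' => absurd h' h⟩
  choose x hx hxA using this
  exact ⟨x, funext hx, hxA⟩

theorem IsIdeal.map_mkQ {L : NLieAlgebra n g} {I A : Submodule ℂ g} (hI : L.IsIdeal I)
    (hA : L.IsIdeal A) : (L.quotient I hI).IsIdeal (A.map I.mkQ) := by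
  rintro v ⟨i, hi⟩
  obtain ⟨x, rfl, hx⟩ := exists_lift_mkQ I A v
  rw [quotient_bracket_mkQ]
  exact Submodule.mem_map_of_mem (hA x ⟨i, hx i hi⟩)

theorem IsIdeal.comap_mkQ {L : NLieAlgebra n g} {I : Submodule ℂ g} (hI : L.IsIdeal I)
    {K : Submodule ℂ (g ⧸ I)} (hK : (L.quotient I hI).IsIdeal K) : L.IsIdeal (K.comap I.mkQ) := by
  rintro x ⟨i, hi⟩
  rw [Submodule.mem_comap, ← L.quotient_bracket_mkQ hI]
  exact hK _ ⟨i, hi⟩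

theorem bracketSpan_quotient {L : NLieAlgebra n g} {I : Submodule ℂ g} (hI : L.IsIdeal I)
    (W : Fin n → Submodule ℂ g) :
    (L.quotient I hI).bracketSpan (fun i => (W i).map I.mkQ) = (L.bracketSpan W).map I.mkQ := by
  refine le_antisymm ?_ ?_
  · rw [bracketSpan_le]
    intro v hv
    choose x hx hxv using hv
    obtain rfl : (fun i => I.mkQ (x i)) = v := funext hxv
    rw [quotient_bracket_mkQ]
    exact Submodule.mem_map_of_mem (L.bracket_mem_bracketSpan hx)
  · rw [Submodule.map_le_iff_le_comap, bracketSpan_le]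
    intro x hx
    rw [Submodule.mem_comap, ← L.quotient_bracket_mkQ hI]
    exact bracket_mem_bracketSpan _ fun i => Submodule.mem_map_of_mem (hx i)

/-- The quotient by the radical has no nonzero abelian ideals. -/
theorem eq_bot_of_isIdeal_quotient_radical [FiniteDimensional ℂ g]
    {L : NLieAlgebra n g} {A : Submodule ℂ (g ⧸ L.radical)}
    (hA : (L.quotient L.radical L.isIdeal_radical).IsIdeal A)
    (h : ∀ x, (∀ i, x i ∈ A) → (L.quotient L.radical L.isIdeal_radical).bracket x = 0) :
    A = ⊥ := by
  obtain ⟨s, hs⟩ := L.isSolvableIdeal_radical.2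
  have hsol : L.IsSolvableIdeal (A.comap L.radical.mkQ) := by
    -- One step takes the preimage into the radical, and `s` more reach zero.
    refine ⟨L.isIdeal_radical.comap_mkQ hA, 1 + s, ?_⟩
    rw [eq_bot_iff, ← hs, derivedSeries_add]
    refine L.derivedSeries_mono (L.bracketSpan_le.mpr fun x hx => ?_) s
    have := h _ hx
    rwa [quotient_bracket_mkQ, Submodule.mkQ_apply, Submodule.Quotient.mk_eq_zero] at this
  rw [eq_bot_iff]
  intro v hv
  obtain ⟨x, rfl⟩ := L.radical.mkQ_surjective v
  rw [Submodule.mem_bot, Submodule.mkQ_apply, Submodule.Quotient.mk_eq_zero]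
  exact (le_sSup hsol : _ ≤ L.radical) hv

/-! ### Metric `n`-Lie algebras -/

section Metric

variable {L : NLieAlgebra n g} {B : LinearMap.BilinForm ℂ g}

theorem IsMetric.ad_left (hB : L.IsMetric B) (x : Fin n → g) (i : Fin n) (u w : g) :
    B (L.ad x i u) w = -B u (L.ad x i w) := by
  rw [ad_apply, hB.invariant, ← ad_apply, hB.symm.eq]

theorem IsMetric.isIdeal_orthogonal (hB : L.IsMetric B) {K : Submodule ℂ g} (hK : L.IsIdeal K) :
    L.IsIdeal (B.orthogonal K) := by
  refine L.isIdeal_iff_ad.mpr fun x i v hv k hk => ?_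
  have := hv _ (L.isIdeal_iff_ad.mp hK x i k hk)
  rw [hB.ad_left, neg_eq_zero] at this
  exact this

/-- Pairing with any `z` and exchanging it with `x j` leaves a bracket in `K` paired with an element
of `K^⊥`. -/
theorem IsMetric.bracket_eq_zero (hB : L.IsMetric B) {K : Submodule ℂ g} (hK : L.IsIdeal K)
    {x : Fin n → g} {i j : Fin n} (hij : i ≠ j) (hi : x i ∈ K) (hj : x j ∈ B.orthogonal K) :
    L.bracket x = 0 := by
  refine hB.nondegenerate.1 _ fun z => ?_
  rw [← L.ad_apply_self x j, hB.ad_left, neg_eq_zero, hB.symm.eq]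
  exact hj _ (hK _ ⟨i, by simpa [hij] using hi⟩)

theorem IsMetric.orthogonal_orthogonal [FiniteDimensional ℂ g] (hB : L.IsMetric B)
    (K : Submodule ℂ g) : B.orthogonal (B.orthogonal K) = K :=
  LinearMap.BilinForm.orthogonal_orthogonal hB.nondegenerate hB.symm.isRefl K

theorem IsMetric.orthogonal_le_comm (hB : L.IsMetric B) {K K' : Submodule ℂ g}
    (h : K ≤ B.orthogonal K') : K' ≤ B.orthogonal K :=
  (LinearMap.BilinForm.le_orthogonal_orthogonal hB.symm.isRefl).trans
    (LinearMap.BilinForm.orthogonal_le h)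

theorem orthogonal_sup_eq_inf (K K' : Submodule ℂ g) :
    B.orthogonal (K ⊔ K') = B.orthogonal K ⊓ B.orthogonal K' := by
  refine le_antisymm (le_inf (LinearMap.BilinForm.orthogonal_le le_sup_left)
    (LinearMap.BilinForm.orthogonal_le le_sup_right)) fun v hv k hk => ?_
  obtain ⟨a, ha, b, hb, rfl⟩ := Submodule.mem_sup.mp hk
  have h1 : B a v = 0 := hv.1 a ha
  have h2 : B b v = 0 := hv.2 b hb
  rw [map_add, LinearMap.add_apply, h1, h2, add_zero]

theorem IsMetric.orthogonal_top (hB : L.IsMetric B) : B.orthogonal ⊤ = ⊥ :=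
  LinearMap.BilinForm.orthogonal_top_eq_bot hB.nondegenerate

theorem isIsotropicIdeal_inf_orthogonal (hB : L.IsMetric B) {K : Submodule ℂ g}
    (hK : L.IsIdeal K) : L.IsIsotropicIdeal B (K ⊓ B.orthogonal K) :=
  ⟨hK.inf (hB.isIdeal_orthogonal hK),
    inf_le_right.trans (LinearMap.BilinForm.orthogonal_le inf_le_left)⟩

theorem IsIsotropicIdeal.le_radical (hn : 2 ≤ n) (hB : L.IsMetric B) {K : Submodule ℂ g}
    (hK : L.IsIsotropicIdeal B K) : K ≤ L.radical :=
  le_sSup (isSolvableIdeal_of_bracket_eq_zero hK.1 fun x hx =>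
    hB.bracket_eq_zero hK.1 (i := ⟨0, by omega⟩) (j := ⟨1, by omega⟩) (by simp) (hx _)
      (hK.2 (hx _)))

theorem IsIsomaximal.radical_inf_orthogonal_le (hn : 2 ≤ n) (hB : L.IsMetric B)
    {I : Submodule ℂ g} (hI : L.IsIsomaximal B I) :
    L.radical ⊓ B.orthogonal L.radical ≤ I := by
  have hz := isIsotropicIdeal_inf_orthogonal hB L.isIdeal_radical
  set z := L.radical ⊓ B.orthogonal L.radical with hz_def
  have hIz : z ≤ B.orthogonal I :=
    inf_le_right.trans (LinearMap.BilinForm.orthogonal_le (hI.prop.le_radical hn hB))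
  refine le_sup_right.trans (hI.le_of_ge (y := I ⊔ z) ⟨hI.prop.1.sup hz.1, ?_⟩ le_sup_left)
  rw [orthogonal_sup_eq_inf]
  exact sup_le (le_inf hI.prop.2 (hB.orthogonal_le_comm hIz)) (le_inf hIz hz.2)

/-- If a metric `n`-Lie algebra with nonzero radical is indecomposable, then its radical contains
its orthogonal. -/
theorem orthogonal_radical_le_radical [FiniteDimensional ℂ g] (hn : 2 ≤ n) (hB : L.IsMetric B)
    (hr : L.radical ≠ ⊥) (hdec : ¬ L.IsDecomposable B) :
    B.orthogonal L.radical ≤ L.radical := by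
  by_contra hnot
  have hR := L.isIdeal_radical
  set R := L.radical with hR_def
  let P := (B.orthogonal R).map R.mkQ
  have hP : (L.quotient R hR).IsIdeal P := hR.map_mkQ (hB.isIdeal_orthogonal hR)
  have hP0 : P ≠ ⊥ := by
    intro h
    have h' := LinearMap.le_ker_iff_map.mpr h
    rw [Submodule.ker_mkQ] at h'
    exact hnot h'
  obtain ⟨J, ⟨hJ, hJP, hJ0⟩, hJmin⟩ := exists_minimal_of_wellFoundedLT
    (fun J => (L.quotient R hR).IsIdeal J ∧ J ≤ P ∧ J ≠ ⊥) ⟨P, hP, le_rfl, hP0⟩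
  obtain ⟨K, hK, hJK⟩ := exists_isCompl_isIdeal hn (L := L.quotient R hR)
    (fun A hA h => eq_bot_of_isIdeal_quotient_radical hA h) hJ hJ0
    fun K hK hKJ hK0 => le_antisymm hKJ (hJmin ⟨hK, hKJ.trans hJP, hK0⟩ hKJ)
  let T := K.comap R.mkQ
  have hT : L.IsIdeal T := hR.comap_mkQ hK
  have hRT : R ≤ T := fun v hv => by
    rw [Submodule.mem_comap, Submodule.mkQ_apply, (Submodule.Quotient.mk_eq_zero R).mpr hv]
    exact K.zero_mem
  -- Modulo `R`, `T` becomes `K` while the image of `R^⊥` contains `J`.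
  have hTP : T ⊔ B.orthogonal R = ⊤ := by
    rw [eq_top_iff]
    intro v _
    have hv : R.mkQ v ∈ J ⊔ K := hJK.sup_eq_top ▸ Submodule.mem_top
    obtain ⟨a, ha, b, hb, hab⟩ := Submodule.mem_sup.mp hv
    obtain ⟨w, hw, rfl⟩ := hJP ha
    rw [← sub_add_cancel v w]
    refine add_mem (Submodule.mem_sup_left ?_) (Submodule.mem_sup_right hw)
    rw [Submodule.mem_comap, map_sub, ← hab, add_sub_cancel_left]
    exact hb
  have hs : L.IsIdeal (B.orthogonal T) := hB.isIdeal_orthogonal hT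
  have hsR : B.orthogonal T ⊓ R = ⊥ := by
    conv_lhs => rw [← hB.orthogonal_orthogonal R]
    rw [← orthogonal_sup_eq_inf, hTP, hB.orthogonal_top]
  have hsT : B.orthogonal T ⊓ T = ⊥ := by
    have h1 := isIsotropicIdeal_inf_orthogonal hB hs
    rw [hB.orthogonal_orthogonal] at h1
    rw [eq_bot_iff, ← hsR]
    exact le_inf inf_le_left (h1.le_radical hn hB)
  refine hdec ⟨T, B.orthogonal T, hT, hs, ?_, ?_, ?_, ?_, ?_⟩
  · exact fun h => hr (le_bot_iff.mp (h ▸ hRT))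
  · intro h
    have h1 : T = ⊤ := by rw [← hB.orthogonal_orthogonal T, h, LinearMap.BilinForm.orthogonal_bot]
    have h2 : K = ⊤ := by
      rw [← Submodule.map_comap_eq_of_surjective R.mkQ_surjective K]
      change T.map R.mkQ = ⊤
      rw [h1, Submodule.map_top, Submodule.range_mkQ]
    have h3 := hJK.inf_eq_bot
    rw [h2, inf_top_eq] at h3
    exact hJ0 h3
  · rw [inf_comm, hsT]
  · rw [hB.orthogonal_orthogonal, hsT]
  · exact (LinearMap.BilinForm.isCompl_orthogonal_iff_disjoint hB.symm.isRefl).mpr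
      (disjoint_iff.mpr (inf_comm T _ ▸ hsT))

/-! ### Ideals between `I` and `I^⊥` -/

/-- The intersection is an isotropic ideal containing `I`, so maximality applies. -/
theorem IsIsomaximal.inf_orthogonal_eq (hB : L.IsMetric B) {I W : Submodule ℂ g}
    (hI : L.IsIsomaximal B I) (hW : L.IsIdeal W) (hIW : I ≤ W) (hWI : W ≤ B.orthogonal I) :
    W ⊓ B.orthogonal W = I :=
  (hI.eq_of_le (isIsotropicIdeal_inf_orthogonal hB hW)
    (le_inf hIW (hB.orthogonal_le_comm hWI))).symm

theorem IsIsomaximal.sup_orthogonal_eq [FiniteDimensional ℂ g] (hB : L.IsMetric B)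
    {I W : Submodule ℂ g} (hI : L.IsIsomaximal B I) (hW : L.IsIdeal W) (hIW : I ≤ W)
    (hWI : W ≤ B.orthogonal I) : W ⊔ B.orthogonal W = B.orthogonal I := by
  rw [← hB.orthogonal_orthogonal (W ⊔ B.orthogonal W), orthogonal_sup_eq_inf,
    hB.orthogonal_orthogonal, inf_comm, hI.inf_orthogonal_eq hB hW hIW hWI]

/-- An ideal `W` between `I` and `I^⊥` that is abelian modulo `I` and contained in
`I + [I^⊥, …, I^⊥]` equals `I`. -/
theorem IsIsomaximal.eq_of_bracketSpan_le [FiniteDimensional ℂ g]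
    (hB : L.IsMetric B) {I W : Submodule ℂ g} (hI : L.IsIsomaximal B I) (hW : L.IsIdeal W)
    (hIW : I ≤ W) (hWI : W ≤ B.orthogonal I) (hWW : L.bracketSpan (fun _ => W) ≤ I)
    (hWd : W ≤ I ⊔ L.bracketSpan fun _ => B.orthogonal I) : W = I := by
  have hIW' : I ≤ B.orthogonal W := hB.orthogonal_le_comm hWI
  rw [← hI.inf_orthogonal_eq hB hW hIW hWI, eq_comm, inf_eq_left]
  refine hWd.trans (sup_le hIW' ((L.bracketSpan_le).mpr fun x hx => ?_))
  -- Split the entries along `I^⊥ = W + W^⊥`. Modulo `W^⊥` only `[W, …, W] ⊆ I ⊆ W^⊥` remains, so `W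
  -- ⊆ W^⊥`.
  simp only [← hI.sup_orthogonal_eq hB hW hIW hWI] at hx
  choose y hy z hz hyz using fun i => Submodule.mem_sup.mp (hx i)
  have h1 : L.bracket x - L.bracket y ∈ B.orthogonal W :=
    L.bracket_sub_mem (hB.isIdeal_orthogonal hW) x y fun i => by
      rw [← hyz i, add_sub_cancel_left]; exact hz i
  rw [← sub_add_cancel (L.bracket x) (L.bracket y)]
  exact add_mem h1 (hIW' (hWW (L.bracket_mem_bracketSpan hy)))

/-- Solvability puts a late derived term of `I^⊥` inside `I`. If one term lies in `I`, the preceding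
one plus `I` is abelian modulo `I`, hence equals `I`. The index `s + 1` stops this descent at `[I^⊥,
…, I^⊥]`. -/
theorem IsIsomaximal.bracketSpan_orthogonal_le [FiniteDimensional ℂ g] (hn : 2 ≤ n)
    (hB : L.IsMetric B) {I : Submodule ℂ g} (hI : L.IsIsomaximal B I)
    (hr : B.orthogonal I ≤ L.radical) : L.bracketSpan (fun _ => B.orthogonal I) ≤ I := by
  obtain ⟨s, hs⟩ := L.isSolvableIdeal_radical.2
  have hs' : L.derivedSeries (B.orthogonal I) (s + 1) ≤ I := by
    have : L.derivedSeries (B.orthogonal I) s = ⊥ :=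
      le_bot_iff.mp (hs ▸ L.derivedSeries_mono hr s)
    rw [derivedSeries_add, this, derivedSeries_bot (by omega)]
    exact bot_le
  have hO := hB.isIdeal_orthogonal hI.prop.1
  have hle : ∀ t, L.derivedSeries (B.orthogonal I) (t + 1) ≤
      L.bracketSpan fun _ => B.orthogonal I := fun t => by
    rw [add_comm, derivedSeries_add]
    induction t with
    | zero => exact le_rfl
    | succ t ih =>
      exact (bracketSpan_le_of_isIdeal (isIdeal_derivedSeries
        (isIdeal_bracketSpan fun _ => hO) t) ⟨0, by omega⟩ le_rfl).trans ih
  clear hs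
  induction s with
  | zero => exact hs'
  | succ s ih =>
    refine ih ?_
    set D := L.derivedSeries (B.orthogonal I) (s + 1) with hD
    have hDI : L.bracketSpan (fun _ => D) ≤ I := hs'
    have hWW : L.bracketSpan (fun _ => D ⊔ I) ≤ I :=
      (derivedSeries_sup_le D hI.prop.1 1).trans (sup_le hDI le_rfl)
    have hDO : D ≤ B.orthogonal I :=
      (hle s).trans (bracketSpan_le_of_isIdeal hO ⟨0, by omega⟩ le_rfl)
    have := hI.eq_of_bracketSpan_le hB ((isIdeal_derivedSeries hO _).sup hI.prop.1) le_sup_right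
      (sup_le hDO hI.prop.2) hWW (sup_le ((hle s).trans le_sup_right) le_sup_left)
    exact le_sup_left.trans this.le

/-- Serves to move two given slots of a bracket to the first two, at the cost of a sign. -/
theorem exists_perm_apply_eq {α : Type*} [DecidableEq α] {a b i j : α} (hab : a ≠ b)
    (hij : i ≠ j) : ∃ σ : Equiv.Perm α, σ a = i ∧ σ b = j := by
  have h : Equiv.swap a i b ≠ i := fun h => by
    rw [Equiv.swap_apply_eq_iff, Equiv.swap_apply_right] at h
    exact hab h.symm
  refine ⟨(Equiv.swap a i).trans (Equiv.swap (Equiv.swap a i b) j), ?_, ?_⟩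
  · rw [Equiv.trans_apply, Equiv.swap_apply_left, Equiv.swap_apply_of_ne_of_ne h.symm hij]
  · rw [Equiv.trans_apply, Equiv.swap_apply_left]

/-- A bracket with two entries in `A` lies in `[A, A, g, …, g]`, whatever their positions. -/
theorem bracket_mem_bracketSpan_ite (hn : 2 ≤ n) (L : NLieAlgebra n g) {A : Submodule ℂ g}
    {x : Fin n → g} {i j : Fin n} (hij : i ≠ j) (hi : x i ∈ A) (hj : x j ∈ A) :
    L.bracket x ∈ L.bracketSpan (fun k => if (k : ℕ) < 2 then A else ⊤) := by
  obtain ⟨σ, h0, h1⟩ := exists_perm_apply_eq (a := (⟨0, by omega⟩ : Fin n)) (b := ⟨1, by omega⟩)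
    (by simp) hij
  have h : L.bracket (x ∘ σ) ∈ L.bracketSpan (fun k => if (k : ℕ) < 2 then A else ⊤) := by
    refine L.bracket_mem_bracketSpan fun k => ?_
    split_ifs with hk
    · have : k = ⟨0, by omega⟩ ∨ k = ⟨1, by omega⟩ := by
        simp only [Fin.ext_iff]; omega
      rcases this with h | h
      · rwa [Function.comp_apply, h, h0]
      · rwa [Function.comp_apply, h, h1]
    · exact Submodule.mem_top
  rw [L.bracket.map_perm] at h
  rcases Int.units_eq_one_or (Equiv.Perm.sign σ) with hσ | hσ <;> rw [hσ] at h <;> simpa using h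

/-- Modulo an ideal `I`, the centralizer of `I^⊥` in `I^⊥` is the orthogonal of
`I + [I^⊥, I^⊥, g, …, g]`. -/
theorem centralizer_inf_map_orthogonal [FiniteDimensional ℂ g] (hn : 2 ≤ n) (hB : L.IsMetric B)
    {I : Submodule ℂ g} (hI : L.IsIdeal I) :
    (L.quotient I hI).centralizer ((B.orthogonal I).map I.mkQ) ⊓ (B.orthogonal I).map I.mkQ =
      (B.orthogonal
        (I ⊔ L.bracketSpan fun i => if (i : ℕ) < 2 then B.orthogonal I else ⊤)).map I.mkQ := by
  have hupd : ∀ (y : Fin n → g) (i : Fin n) (x : g),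
      (L.quotient I hI).bracket (Function.update (fun k => I.mkQ (y k)) i (I.mkQ x)) =
        I.mkQ (L.ad y i x) := fun y i x => by
    rw [ad_apply, ← quotient_bracket_mkQ (hI := hI)]
    congr 1
    exact (Function.comp_update I.mkQ y i x).symm
  -- Both inclusions rest on invariance: `x` is orthogonal to `[I^⊥, I^⊥, g, …, g]` exactly when
  -- `[x, I^⊥, g, …, g] ⊆ I^⊥⊥ = I`.
  rw [orthogonal_sup_eq_inf]
  refine le_antisymm ?_ ?_
  · rintro _ ⟨hx, x, hxI, rfl⟩
    refine ⟨x, ⟨hxI, ?_⟩, rfl⟩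
    suffices L.bracketSpan _ ≤ LinearMap.ker (B.flip x) from this
    refine L.bracketSpan_le.mpr fun y hy => ?_
    have h0 : y ⟨0, by omega⟩ ∈ B.orthogonal I := by simpa using hy ⟨0, by omega⟩
    have h1 : y ⟨1, by omega⟩ ∈ B.orthogonal I := by simpa using hy ⟨1, by omega⟩
    have h2 := hx (fun k => I.mkQ (y k)) ⟨0, by omega⟩ ⟨1, by omega⟩ (by simp)
      (Submodule.mem_map_of_mem h1)
    rw [hupd, Submodule.mkQ_apply, Submodule.Quotient.mk_eq_zero] at h2
    change B (L.bracket y) x = 0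
    rw [← L.ad_apply_self y ⟨0, by omega⟩, hB.ad_left,
      neg_eq_zero, hB.symm.eq]
    exact h0 _ h2
  · rintro _ ⟨x, ⟨hxI, hx⟩, rfl⟩
    refine ⟨fun v i j hij hv => ?_, x, hxI, rfl⟩
    obtain ⟨y, rfl, hy⟩ := exists_lift_mkQ I (B.orthogonal I) v
    rw [hupd, Submodule.mkQ_apply, Submodule.Quotient.mk_eq_zero, ← hB.orthogonal_orthogonal I]
    intro z hz
    change B z _ = 0
    rw [← neg_eq_zero, ← hB.ad_left]
    exact hx _ (bracket_mem_bracketSpan_ite hn L hij (by simpa using hz)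
      (by simpa [hij.symm] using hy j hv))

end Metric
end NLieAlgebra

/-! ### The theorem -/

open NLieAlgebra

theorem theorem3p4 {n : ℕ} (hn : 2 ≤ n) {g : Type*} [AddCommGroup g] [Module ℂ g]
    [FiniteDimensional ℂ g] (L : NLieAlgebra n g) (B : LinearMap.BilinForm ℂ g)
    (hB : L.IsMetric B) (hr : L.radical ≠ ⊥)
    (I : Submodule ℂ g) (hI : L.IsIsomaximal B I) :
    (L.radical ⊓ B.orthogonal L.radical ≤ I ∧ I ≤ L.radical) ∧
    (¬ L.IsDecomposable B →
      -- `I^⊥ ⊆ r`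
      B.orthogonal I ≤ L.radical ∧
      -- `A := I^⊥ / I` is an abelian subalgebra of `g / I`
      (L.quotient I hI.prop.1).IsAbelianSubalgebra ((B.orthogonal I).map I.mkQ) ∧
      -- `A = [A, A, g / I, …, g / I] ⊕ (C_{g / I}(A) ∩ A)`
      ((L.quotient I hI.prop.1).bracketSpan
            (fun i => if (i : ℕ) < 2 then (B.orthogonal I).map I.mkQ else ⊤) ⊔
          ((L.quotient I hI.prop.1).centralizer ((B.orthogonal I).map I.mkQ) ⊓
            (B.orthogonal I).map I.mkQ) =
          (B.orthogonal I).map I.mkQ ∧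
        Disjoint
          ((L.quotient I hI.prop.1).bracketSpan
            (fun i => if (i : ℕ) < 2 then (B.orthogonal I).map I.mkQ else ⊤))
          ((L.quotient I hI.prop.1).centralizer ((B.orthogonal I).map I.mkQ) ⊓
            (B.orthogonal I).map I.mkQ))) := by
  have hrI := hI.radical_inf_orthogonal_le hn hB
  refine ⟨⟨hrI, hI.prop.le_radical hn hB⟩, fun hdec => ?_⟩
  have hII := hI.prop.1
  have hO := hB.isIdeal_orthogonal hII
  have hOr : B.orthogonal I ≤ L.radical := by
    -- As `r^⊥ ⊆ r`, the first part reads `r^⊥ ⊆ I`; now take orthogonals.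
    rw [inf_eq_right.mpr (orthogonal_radical_le_radical hn hB hr hdec)] at hrI
    rw [← hB.orthogonal_orthogonal L.radical]
    exact LinearMap.BilinForm.orthogonal_le hrI
  refine ⟨hOr, ⟨fun x hx => hII.map_mkQ hO x ⟨⟨0, by omega⟩, hx _⟩, ?_⟩, ?_⟩
  · rw [bracketSpan_quotient hII fun _ => B.orthogonal I, ← LinearMap.le_ker_iff_map,
      Submodule.ker_mkQ]
    exact hI.bracketSpan_orthogonal_le hn hB hOr
  · set W : Fin n → Submodule ℂ g := fun i => if (i : ℕ) < 2 then B.orthogonal I else ⊤ with hW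
    have hWid : ∀ i, L.IsIdeal (W i) := fun i => by
      simp only [hW]
      split_ifs
      exacts [hO, L.isIdeal_top]
    have hspan : (L.quotient I hII).bracketSpan
        (fun i => if (i : ℕ) < 2 then (B.orthogonal I).map I.mkQ else ⊤) =
          (I ⊔ L.bracketSpan W).map I.mkQ := by
      rw [Submodule.map_sup, Submodule.mkQ_map_self, bot_sup_eq, ← bracketSpan_quotient hII]
      congr 1
      ext1 i
      simp only [hW]
      split_ifs
      · rfl
      · rw [Submodule.map_top, Submodule.range_mkQ]
    have hPid : L.IsIdeal (I ⊔ L.bracketSpan W) := hII.sup (isIdeal_bracketSpan hWid)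
    have hPO : I ⊔ L.bracketSpan W ≤ B.orthogonal I :=
      sup_le hI.prop.2 (bracketSpan_le_of_isIdeal hO ⟨0, by omega⟩ (by simp [hW]))
    rw [hspan, centralizer_inf_map_orthogonal hn hB hII]
    refine ⟨?_, ?_⟩
    · rw [← Submodule.map_sup, hI.sup_orthogonal_eq hB hPid le_sup_left hPO]
    · rw [Submodule.disjoint_def]
      rintro _ ⟨p, hp, rfl⟩ ⟨q, hq, hqp⟩
      -- The representatives differ by an element of `I`, which lies in the orthogonal too, so `p`
      -- is in the intersection, namely `I`.
      have hpq : q - p ∈ I := (Submodule.Quotient.eq I).mp hqp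
      have hp' : p ∈ B.orthogonal (I ⊔ L.bracketSpan W) := by
        rw [← sub_sub_cancel q p]
        exact sub_mem hq (hB.orthogonal_le_comm hPO hpq)
      have hpI : p ∈ I := hI.inf_orthogonal_eq hB hPid le_sup_left hPO ▸ ⟨hp, hp'⟩
      rw [Submodule.mkQ_apply, Submodule.Quotient.mk_eq_zero]
      exact hpI
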